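/- Let $K$ be a (nonarchimedean) local field, i.e. a field that is complete with respect to a nontrivial discrete valuation and has finite residue field. Write $\mathcal O_K$ for its valuation ring, $\mathfrak m_K$ for the maximal ideal and $U_K=\mathcal O_K^\times$ for the unit group. Let $L/K$ be a finite extension of local fields (the valuation of $L$ extends that of $K$ up to equivalence) that is unramified, i.e. $\mathfrak m_K\mathcal O_L=\mathfrak m_L$, and let $\operatorname{Gal}(L/K)$ be the group of $K$-automorphisms of $L$, acting on $U_L$. Then the Tate cohomology groups $$H_T^r(\operatorname{Gal}(L/K),U_L)=0\qquad\text{for all } r\in\mathbb Z.$$ Moreover the norm $\operatorname{Nm}_{L/K}:L\to K$ restricts to a homomorphism $U_L\to U_K$, and this homomorphism is surjective. -/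

import Mathlib

open scoped ValuativeRel

universe u v

namespace LocalUnits

open ValuativeRel Polynomial

/-- There are arbitrarily large integers that are units of the valuation ring. -/
theorem exists_natCast_valuation_eq_one (E : Type*) [Field E] [ValuativeRel E] (B : ℕ) :
    ∃ m : ℕ, B < m ∧ valuation E (m : E) = 1 := by
  have hle : ∀ n : ℕ, valuation E (n : E) ≤ 1 := fun n =>
    (natCast_mem (valuation E).integer n)
  by_cases h : valuation E ((B + 1 : ℕ) : E) = 1
  · exact ⟨B + 1, by omega, h⟩
  · refine ⟨B + 2, by omega, ?_⟩
    have hlt := lt_of_le_of_ne (hle (B + 1)) h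
    have : ((B + 2 : ℕ) : E) = 1 + ((B + 1 : ℕ) : E) := by push_cast; ring
    rw [this]
    exact Valuation.map_one_add_of_lt _ hlt

section Automorphisms

variable {E : Type*} [Field E] [ValuativeRel E] [TopologicalSpace E]
  [IsNonarchimedeanLocalField E]

/-- Hensel's lemma: a principal unit of a local field has an `m`-th root if the integer `m` is a
unit of the valuation ring. -/
theorem exists_pow_eq_one_add {x : E} (hx : valuation E x < 1) {m : ℕ} (hm0 : m ≠ 0)
    (hm : valuation E (m : E) = 1) : ∃ y : E, y ^ m = 1 + x := by
  let := IsTopologicalAddGroup.rightUniformSpace E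
  have := isUniformAddGroup_of_addCommGroup (G := E)
  let a : 𝒪[E] := ⟨x, hx.le⟩
  have ha : a ∈ 𝓂[E] := by
    rw [IsLocalRing.mem_maximalIdeal, mem_nonunits_iff]
    intro hu
    rw [Valuation.Integers.isUnit_iff_valuation_eq_one
      (Valuation.integer.integers (valuation E))] at hu
    exact hx.ne hu
  have hmu : IsUnit (m : 𝒪[E]) := by
    rw [Valuation.Integers.isUnit_iff_valuation_eq_one
      (Valuation.integer.integers (valuation E))]
    simpa using hm
  obtain ⟨b, hb, -⟩ := HenselianRing.is_henselian (R := 𝒪[E]) (I := 𝓂[E])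
    (X ^ m - C (1 + a)) (monic_X_pow_sub_C _ hm0) 1 (by simpa using ha)
    (by
      apply IsUnit.map
      simpa [derivative_X_pow] using hmu)
  refine ⟨b, ?_⟩
  have h : b ^ m = 1 + a := by simpa [sub_eq_zero] using hb
  simpa using congrArg (fun t : 𝒪[E] => (t : E)) h

/-- An automorphism of a local field maps the maximal ideal into the valuation ring. -/
theorem valuation_map_le_one_of_lt (σ : E ≃+* E) {x : E} (hx : valuation E x < 1) :
    valuation E (σ x) ≤ 1 := by
  have h1 : valuation E (1 + x) = 1 := Valuation.map_one_add_of_lt _ hx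
  have hne : 1 + x ≠ 0 := by
    intro h
    simp [h] at h1
  have hne' : 1 + σ x ≠ 0 := by
    have := (map_ne_zero σ).2 hne
    simpa using this
  let e := IsNonarchimedeanLocalField.valueGroupWithZeroIsoInt E
  have key : WithZero.log (e (valuation E (1 + σ x))) = 0 := by
    by_contra hlog
    obtain ⟨m, hm, hmv⟩ := exists_natCast_valuation_eq_one E
      (WithZero.log (e (valuation E (1 + σ x)))).natAbs
    obtain ⟨y, hy⟩ := exists_pow_eq_one_add hx (by omega) hmv
    have h2 : 1 + σ x = (σ y) ^ m := by rw [← map_pow, hy]; simp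
    rw [h2, map_pow, map_pow, WithZero.log_pow, nsmul_eq_mul] at hlog hm
    rw [Int.natAbs_mul, Int.natAbs_natCast] at hm
    have : 0 < (WithZero.log (e (valuation E (σ y)))).natAbs := by
      rw [Int.natAbs_pos]
      exact right_ne_zero_of_mul hlog
    nlinarith
  have hv : valuation E (1 + σ x) = 1 := by
    have hz : e (valuation E (1 + σ x)) ≠ 0 := by simpa using hne'
    have h3 : e (valuation E (1 + σ x)) = e 1 := by
      rw [← WithZero.exp_log hz, key, WithZero.exp_zero, map_one]
    exact EquivLike.injective e h3
  have : σ x = (1 + σ x) - 1 := by ring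
  rw [this]
  exact (Valuation.map_sub _ _ _).trans (by simp [hv])

/-- An automorphism of a local field maps the valuation ring into itself. -/
theorem valuation_map_le_one (σ : E ≃+* E) {x : E} (hx : valuation E x ≤ 1) :
    valuation E (σ x) ≤ 1 := by
  by_contra! hlt
  obtain ⟨w, hw0, hw⟩ := Valuation.IsNontrivial.exists_lt_one (v := valuation E)
  have hw0' : w ≠ 0 := by simpa using hw0
  let e := IsNonarchimedeanLocalField.valueGroupWithZeroIsoInt E
  have hn : ∀ n : ℕ, valuation E (σ w) * valuation E (σ x) ^ n ≤ 1 := by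
    intro n
    have := valuation_map_le_one_of_lt σ (x := w * x ^ n) (by
      rw [map_mul, map_pow]
      exact (mul_le_of_le_one_right' (pow_le_one' hx n)).trans_lt hw)
    simpa using this
  have hx0 : valuation E (σ x) ≠ 0 := (zero_lt_one.trans hlt).ne'
  have hw1 : valuation E (σ w) ≠ 0 := by simpa using hw0'
  have hex : e (valuation E (σ x)) ≠ 0 := by simpa using hx0
  have hew : e (valuation E (σ w)) ≠ 0 := by simpa using hw1
  have hpos : 0 < WithZero.log (e (valuation E (σ x))) := by
    rw [WithZero.lt_log_iff_exp_lt hex, WithZero.exp_zero, ← map_one e]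
    exact e.strictMono hlt
  have hle : ∀ n : ℕ, WithZero.log (e (valuation E (σ w))) +
      n * WithZero.log (e (valuation E (σ x))) ≤ 0 := by
    intro n
    have h := e.strictMono.monotone (hn n)
    rw [map_mul, map_pow, map_one] at h
    have h' := (WithZero.log_le_log (mul_ne_zero hew (pow_ne_zero n hex)) one_ne_zero).2 h
    rw [WithZero.log_mul hew (pow_ne_zero n hex), WithZero.log_pow, WithZero.log_one,
      nsmul_eq_mul] at h'
    exact h'
  have h := hle ((WithZero.log (e (valuation E (σ w)))).natAbs + 1)
  have habs := neg_abs_le (WithZero.log (e (valuation E (σ w))))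
  push_cast at h
  nlinarith [abs_nonneg (WithZero.log (e (valuation E (σ w))))]

end Automorphisms

section Extension

variable (K : Type v) (L : Type u)
  [Field K] [ValuativeRel K] [TopologicalSpace K] [IsNonarchimedeanLocalField K]
  [Field L] [ValuativeRel L] [TopologicalSpace L] [IsNonarchimedeanLocalField L]
  [Algebra K L]

/-- The inclusion `𝒪_K → 𝒪_L` of valuation rings in an extension `L / K` of local fields. -/
noncomputable def integerMap [ValuativeExtension K L] : 𝒪[K] →+* 𝒪[L] :=
  (algebraMap K L).restrict 𝒪[K] 𝒪[L] fun x hx => by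
    rw [Valuation.mem_integer_iff, ← map_one (valuation L), ← map_one (algebraMap K L),
      ← Valuation.Compatible.vle_iff_le, ValuativeExtension.vle_iff_vle,
      Valuation.Compatible.vle_iff_le (v := valuation K), map_one]
    exact hx

/-- An extension `L / K` of local fields is unramified if `𝔪_K 𝒪_L = 𝔪_L`, that is, if its
ramification index is `1`. (The residue fields are finite, so the residue extension is
automatically separable.) -/
def IsUnramified [ValuativeExtension K L] : Prop :=
  Ideal.map (integerMap K L) 𝓂[K] = 𝓂[L]

variable {K L} in
/-- The restriction of `σ ∈ Gal(L / K)` to a ring endomorphism of the valuation ring of the local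
field `L`. -/
noncomputable def galInteger (σ : Gal(L/K)) : 𝒪[L] →+* 𝒪[L] :=
  (σ : L →+* L).restrict 𝒪[L] 𝒪[L] fun _ hx => valuation_map_le_one (σ : L ≃+* L) hx

/-- The unit group `U_L = 𝒪_Lˣ`, written additively, with the action of `Gal(L / K)` that restricts
its action on `L`, as a representation. The coefficient ring is `ℤ`, lifted to the universe of `L`
only because Tate cohomology is set up for a group and a coefficient ring in the same universe. -/
noncomputable def unitsRepresentation :
    Representation (ULift.{u} ℤ) Gal(L/K) (Additive 𝒪[L]ˣ) where
  toFun σ :=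
    { toFun := fun a => Additive.ofMul (Units.map (galInteger σ : 𝒪[L] →* 𝒪[L]) a.toMul)
      map_add' := fun a b => by rw [toMul_add, map_mul, ofMul_mul]
      map_smul' := fun n a => by
        rw [ULift.smul_def, toMul_zsmul, map_zpow, ofMul_zpow, RingHom.id_apply, ULift.smul_def] }
  map_one' := rfl
  map_mul' _ _ := rfl

/-- The unit group `U_L` as a `Gal(L / K)`-module. -/
noncomputable abbrev unitsRep : Rep.{u} (ULift.{u} ℤ) Gal(L/K) :=
  Rep.of (unitsRepresentation K L)

end Extension

end LocalUnits

/-! Let `G = Gal(L/K)`. It acts faithfully on the residue field of `L`, and the residue extension is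
one of finite fields, so `G` is cyclic. Tate cohomology of a finite cyclic group has period two, so
for a generator `σ` two facts about `U_L` suffice: every fixed unit is a norm, and every unit of
norm 1 has the form `σ y / y`.

The fixed units are `U_K`, so the first fact is the surjectivity of the norm. No successive
approximation along the unit filtration is needed. Given `u`,
`FiniteField.exists_norm_eq_and_adjoin_eq_top` yields a generator `β` of the residue extension whose
norm is the residue of `u`. Lift its minimal polynomial to a monic `g` of degree `n` with constant
term `(-1)^n u`. Hensel's lemma lifts `β` to a root `a` of `g`; then `a` generates `L` with minimal
polynomial `g`, so its norm is `u` (`UnramifiedDVR.exists_norm_eq`). Lifting a residue generator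
also shows that `L/K` is Galois and that `G` acts faithfully.

For the second fact, Hilbert 90 writes a unit of norm 1 as `z / σ z` with `z` in `L`. A uniformizer
of `K` is also one of `L`, and `σ` fixes it, so its powers cancel and `z` may be taken to be a unit.
-/

/-! ### Tate cohomology of finite cyclic groups. -/

open CategoryTheory in
/-- A representation of a finite cyclic group has trivial Tate cohomology in all degrees if it does
so in the degrees `0` and `-1`. -/
theorem isZero_tateCohomology_of_forall_mem_zpowers {R G : Type u} [CommRing R] [Group G]
    [Fintype G] (A : Rep.{u} R G) (g : G) (hg : ∀ x, x ∈ Subgroup.zpowers g)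
    (h₀ : ∀ x, A.ρ g x = x → ∃ y, A.ρ.norm y = x)
    (h₁ : ∀ x, A.ρ.norm x = 0 → ∃ y, A.ρ g y - y = x) (r : ℤ) :
    Limits.IsZero (tateCohomology A r) := by
  classical
  have comm : ∀ a b : G, a * b = b * a := by
    intro a b
    obtain ⟨m, rfl⟩ := hg a
    obtain ⟨n, rfl⟩ := hg b
    simp only [← zpow_add, add_comm]
  let : CommGroup G := { ‹Group G› with mul_comm := comm }
  have e₀ : (Rep.FiniteCyclicGroup.normHomCompSub A g).Exact := by
    rw [ShortComplex.moduleCat_exact_iff]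
    intro x hx
    exact h₀ x (sub_eq_zero.1 hx)
  have e₁ : (Rep.FiniteCyclicGroup.subCompNormHom A g).Exact := by
    rw [ShortComplex.moduleCat_exact_iff]
    intro x hx
    exact h₁ x hx
  rw [ShortComplex.exact_iff_isZero_homology] at e₀ e₁
  have hN : A.tateNorm ≫ (groupCohomology.cochainsIso₀ A).hom =
      (groupHomology.chainsIso₀ A).hom ≫ A.norm.toModuleCatHom :=
    (Iso.eq_comp_inv _).1 (Category.assoc _ _ _).symm
  -- The cases are `r = 0`, `r = n + 1`, `r = -1` and `r = -(n + 2)`. In the second and fourth, Tate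
  -- cohomology is ordinary cohomology or homology in degree `n + 1`, where periodicity applies.
  -- Degrees 0 and -1 touch the norm map and are read off the Tate complex.
  rcases r with (_ | n) | (_ | n)
  · change Limits.IsZero ((tateComplex A).homology 0)
    rw [← HomologicalComplex.exactAt_iff_isZero_homology,
      HomologicalComplex.exactAt_iff' _ (-1) 0 1 (by simp) (by simp),
      ShortComplex.exact_iff_of_iso (ShortComplex.isoMk (groupHomology.chainsIso₀ A)
        (groupCohomology.cochainsIso₀ A) (groupCohomology.cochainsIso₁ A)
        (S₂ := ShortComplex.mk A.norm.toModuleCatHom (groupCohomology.d₀₁ A)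
          (Rep.norm_comp_d_eq_zero A))
        hN.symm (groupCohomology.comp_d₀₁_eq A)),
      ShortComplex.moduleCat_exact_iff]
    intro x hx
    exact h₀ x (sub_eq_zero.1 (congrFun hx g))
  · have : NeZero (n + 1) := ⟨by omega⟩
    refine Limits.IsZero.of_iso ?_ ((TateCohomology.isoGroupCohomology (n + 1)).app A)
    by_cases hn : Even (n + 1)
    · exact e₀.of_iso (Rep.FiniteCyclicGroup.groupCohomologyIsoEven A g hg (n + 1) hn)
    · exact e₁.of_iso (Rep.FiniteCyclicGroup.groupCohomologyIsoOdd A g hg (n + 1)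
        (Nat.not_even_iff_odd.1 hn))
  · change Limits.IsZero ((tateComplex A).homology (-1))
    rw [← HomologicalComplex.exactAt_iff_isZero_homology,
      HomologicalComplex.exactAt_iff' _ (-2) (-1) 0 (by simp) (by simp),
      ShortComplex.exact_iff_of_iso (ShortComplex.isoMk (groupHomology.chainsIso₁ A)
        (groupHomology.chainsIso₀ A) (groupCohomology.cochainsIso₀ A)
        (S₂ := ShortComplex.mk (groupHomology.d₁₀ A) A.norm.toModuleCatHom
          (Rep.comp_eq_zero A))
        (groupHomology.comp_d₁₀_eq A) hN.symm),
      ShortComplex.moduleCat_exact_iff]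
    intro x hx
    obtain ⟨y, hy⟩ := h₁ x hx
    -- The differential sends `single h y` to `h⁻¹ y - y`, hence the inverse.
    refine ⟨Finsupp.single g⁻¹ y, ?_⟩
    exact (groupHomology.d₁₀_single A g⁻¹ y).trans (by simpa using hy)
  · have : NeZero (n + 1) := ⟨by omega⟩
    refine Limits.IsZero.of_iso ?_ ((TateCohomology.isoGroupHomology (.negSucc (n + 1)) (n + 1)
      (Int.negSucc_eq _)).app A)
    by_cases hn : Even (n + 1)
    · exact e₁.of_iso (Rep.FiniteCyclicGroup.groupHomologyIsoEven A g hg (n + 1) hn)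
    · exact e₀.of_iso (Rep.FiniteCyclicGroup.groupHomologyIsoOdd A g hg (n + 1)
        (Nat.not_even_iff_odd.1 hn))

/-! ### Finite fields. -/

/-- Every nonzero element of a finite field `k` is the norm of a generator of a given finite
extension `l / k`. -/
theorem FiniteField.exists_norm_eq_and_adjoin_eq_top (k l : Type*) [Field k] [Field l] [Finite l]
    [Algebra k l] (u : kˣ) :
    ∃ β : l, Algebra.norm k β = u ∧ Algebra.adjoin k {β} = ⊤ := by
  have : Finite k := Finite.of_injective _ (algebraMap k l).injective
  obtain ⟨ζ, hζ⟩ := IsCyclic.exists_generator (α := lˣ)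
  let ν : lˣ →* kˣ := Units.map (Algebra.norm k)
  obtain ⟨w, hw⟩ := FiniteField.unitsMap_norm_surjective k l (u / ν ζ)
  -- `ν ζ` generates `kˣ`. Splitting off one factor `ν ζ` makes the final exponent `j + 1` positive,
  -- so that `u = 1` does not lead to `β = 1`.
  have hu : u / ν ζ ∈ Submonoid.powers (ν ζ) := by
    obtain ⟨m, rfl⟩ := mem_powers_iff_mem_zpowers.2 (hζ w)
    exact ⟨m, by rw [← hw, map_pow]⟩
  classical
  rw [mem_powers_iff_mem_range_orderOf, Finset.mem_image] at hu
  obtain ⟨j, hj, hju⟩ := hu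
  have hj' : j + 1 ≤ Nat.card k - 1 := by
    rw [← Nat.card_units]
    exact (Finset.mem_range.1 hj).trans_le (Nat.le_of_dvd Nat.card_pos (orderOf_dvd_natCard _))
  refine ⟨(ζ ^ (j + 1) : lˣ), ?_, ?_⟩
  · have : ν (ζ ^ (j + 1)) = u := by rw [map_pow, pow_succ, hju, div_mul_cancel]
    exact congrArg Units.val this
  · rw [← IntermediateField.adjoin_simple_toSubalgebra_of_isAlgebraic
      (Algebra.IsAlgebraic.isAlgebraic _), ← IntermediateField.top_toSubalgebra]
    congr 1
    set E := IntermediateField.adjoin k {((ζ ^ (j + 1) : lˣ) : l)} with hE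
    -- Write `q = |k|`. If `E` were proper, then `|l| ≥ |E|² ≥ q|E|`. But `ζ ^ (j + 1)` lies in `E`,
    -- so `|l| - 1` divides `(j + 1)(|E| - 1) ≤ (q - 1)(|E| - 1)`, which is less than `q|E| - 1`.
    by_contra hne
    have hr : 2 ≤ Module.finrank E l := by
      have h0 : 0 < Module.finrank E l := Module.finrank_pos
      have h1 : Module.finrank E l ≠ 1 := fun h =>
        hne (IntermediateField.finrank_eq_one_iff_eq_top.1 h)
      omega
    have hkE : Nat.card k ≤ Nat.card E :=
      Nat.card_le_card_of_injective _ (algebraMap k E).injective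
    have hk : 2 ≤ Nat.card k := Finite.one_lt_card
    have hEl : Nat.card k * Nat.card E ≤ Nat.card l := by
      rw [Module.natCard_eq_pow_finrank (K := E) (V := l)]
      calc Nat.card k * Nat.card E ≤ Nat.card E ^ 2 := by rw [sq]; gcongr
        _ ≤ _ := Nat.pow_le_pow_right Nat.card_pos hr
    have hdvd : Nat.card l - 1 ∣ (j + 1) * (Nat.card E - 1) := by
      rw [← Nat.card_units, ← orderOf_eq_card_of_forall_mem_zpowers hζ, orderOf_dvd_iff_pow_eq_one,
        pow_mul]
      have hmem : ((ζ ^ (j + 1) : lˣ) : l) ∈ E := IntermediateField.mem_adjoin_simple_self k _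
      have h1 : (⟨_, hmem⟩ : E) ^ (Nat.card E - 1) = 1 := by
        have := Fintype.ofFinite E
        rw [Nat.card_eq_fintype_card]
        refine FiniteField.pow_card_sub_one_eq_one _ fun h => ?_
        exact (ζ ^ (j + 1)).ne_zero (congrArg Subtype.val h)
      exact Units.ext (by simpa using congrArg Subtype.val h1)
    have hle := Nat.le_of_dvd (Nat.mul_pos (by omega) (by omega)) hdvd
    have h2 : (j + 1) * (Nat.card E - 1) ≤ (Nat.card k - 1) * (Nat.card E - 1) := by gcongr
    obtain ⟨a, ha⟩ : ∃ a, Nat.card k = a + 2 := ⟨_, (Nat.sub_add_cancel hk).symm⟩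
    obtain ⟨b, hb⟩ : ∃ b, Nat.card E = b + 2 := ⟨_, (Nat.sub_add_cancel (hk.trans hkE)).symm⟩
    rw [ha, hb] at h2 hEl
    simp only [Nat.add_succ_sub_one] at h2
    rw [hb] at hle
    simp only [Nat.add_succ_sub_one] at hle
    have : Nat.card l ≤ (a + 1) * (b + 1) + 1 := by omega
    nlinarith

/-! ### Precompleteness and Hilbert 90. -/

/-- A finite power of an `I`-adically precomplete ring is `I`-adically precomplete. -/
theorem IsPrecomplete.pi {R ι : Type*} [CommRing R] [Finite ι] (I : Ideal R) [IsPrecomplete I R] :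
    IsPrecomplete I (ι → R) := by
  classical
  have := Fintype.ofFinite ι
  have mem (n : ℕ) (x : ι → R) : x ∈ (I ^ n • ⊤ : Submodule R (ι → R)) ↔ ∀ i, x i ∈ I ^ n := by
    constructor
    · intro hx i
      refine Submodule.smul_induction_on hx (fun r hr y _ => ?_) fun y z hy hz => ?_
      · exact Ideal.mul_mem_right _ _ hr
      · exact Ideal.add_mem _ hy hz
    · intro hx
      rw [← Finset.univ_sum_single x]
      refine Submodule.sum_mem _ fun i _ => ?_
      have : Pi.single i (x i) = x i • (Pi.single i 1 : ι → R) := by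
        rw [← Pi.single_smul, smul_eq_mul, mul_one]
      rw [this]
      exact Submodule.smul_mem_smul (hx i) trivial
  refine ⟨fun f hf => ?_⟩
  have (i : ι) : ∃ L : R, ∀ n, f n i ≡ L [SMOD (I ^ n • ⊤ : Submodule R R)] := by
    refine IsPrecomplete.prec' (fun n => f n i) fun {m n} hmn => ?_
    have := hf hmn
    rw [SModEq.sub_mem, mem] at this
    rw [SModEq.sub_mem]
    simpa using this i
  choose L hL using this
  refine ⟨L, fun n => ?_⟩
  rw [SModEq.sub_mem, mem]
  intro i
  simpa [SModEq.sub_mem] using hL i n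

/-- Hilbert's theorem 90 for a finite cyclic extension. -/
theorem exists_div_eq_of_norm_eq_one {K L : Type*} [Field K] [Field L] [Algebra K L]
    [FiniteDimensional K L] [IsGalois K L] {σ : Gal(L/K)}
    (hσ : ∀ τ, τ ∈ Subgroup.zpowers σ) {x : L} (hx : Algebra.norm K x = 1) :
    ∃ z : L, z ≠ 0 ∧ z / σ z = x := by
  classical
  let n := orderOf σ
  have hn : 0 < n := orderOf_pos σ
  let P : ℕ → L := fun i => ∏ j ∈ Finset.range i, (σ ^ j) x
  have hPn : P n = 1 := by
    rw [← map_one (algebraMap K L), ← hx, Algebra.norm_eq_prod_automorphisms,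
      ← IsCyclic.image_range_orderOf hσ, Finset.prod_image fun i hi j hj hij =>
        pow_injOn_Iio_orderOf (Finset.mem_range.1 hi) (Finset.mem_range.1 hj) hij]
  have hP (i : ℕ) : P (i + 1) = x * σ (P i) := by
    simp only [P, Finset.prod_range_succ', pow_zero, AlgEquiv.one_apply, map_prod, pow_succ',
      AlgEquiv.mul_apply, mul_comm x]
  have hli := (linearIndependent_monoidHom L L).comp
    (fun i : Fin n => (((σ ^ (i : ℕ) : Gal(L/K)) : L →+* L) : L →* L)) fun i j hij =>
      Fin.ext (pow_injOn_Iio_orderOf i.2 j.2 (AlgEquiv.ext fun y => DFunLike.congr_fun hij y))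
  -- Dedekind's independence of characters; the coefficient `P 0 = 1` is nonzero.
  obtain ⟨c, hc⟩ : ∃ c, ∑ i : Fin n, P i * (σ ^ (i : ℕ)) c ≠ 0 := by
    by_contra! h0
    have := Fintype.linearIndependent_iff.1 hli (fun i => P i) (by
      ext c
      simpa using h0 c) ⟨0, hn⟩
    simp [P] at this
  refine ⟨_, hc, ?_⟩
  rw [div_eq_iff ((map_ne_zero σ).2 hc), Fin.sum_univ_eq_sum_range (fun i => P i * (σ ^ i) c) n,
    map_sum, Finset.mul_sum]
  have hstep (i : ℕ) : x * σ (P i * (σ ^ i) c) = P (i + 1) * (σ ^ (i + 1)) c := by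
    rw [hP, map_mul, pow_succ', AlgEquiv.mul_apply, mul_assoc]
  simp only [hstep]
  -- Applying `x * σ` shifts the index by one; the sum is unchanged because the terms at `n` and `0`
  -- agree.
  have h1 := Finset.sum_range_succ (fun i => P i * (σ ^ i) c) n
  have h2 := Finset.sum_range_succ' (fun i => P i * (σ ^ i) c) n
  have h3 : P n * (σ ^ n) c = P 0 * (σ ^ 0) c := by
    rw [hPn, pow_orderOf_eq_one, pow_zero]
    simp [P]
  rw [h1, h3] at h2
  exact add_right_cancel h2

/-! ### Unramified extensions of complete local rings. -/

namespace UnramifiedDVR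

open IsLocalRing Polynomial

section Integral

variable {A B : Type*} [CommRing A] [CommRing B] [IsLocalRing A] [IsLocalRing B] [Algebra A B]
  [IsLocalHom (algebraMap A B)]

theorem aeval_residue (p : A[X]) (b : B) :
    aeval (residue B b) (p.map (residue A)) = residue B (aeval b p) := by
  rw [← ResidueField.algebraMap_eq A, aeval_map_algebraMap, ← ResidueField.algebraMap_eq B,
    aeval_algebraMap_apply]

/-- Hensel's lemma for roots in an extension of the residue field. -/
theorem exists_root_residue_eq [IsAdicComplete (maximalIdeal B) B] {g : A[X]} (hg : g.Monic)
    (hs : (g.map (residue A)).Separable) {β : ResidueField B}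
    (hβ : aeval β (g.map (residue A)) = 0) : ∃ a : B, aeval a g = 0 ∧ residue B a = β := by
  obtain ⟨b, rfl⟩ := residue_surjective β
  obtain ⟨a, ha, hab⟩ := HenselianRing.is_henselian (R := B) (I := maximalIdeal B)
    (g.map (algebraMap A B)) (hg.map _) b
    (by rw [eval_map_algebraMap, ← residue_eq_zero_iff, ← aeval_residue, hβ])
    (by
      have := hs.aeval_derivative_ne_zero hβ
      rw [derivative_map, aeval_residue] at this
      rw [derivative_map, eval_map_algebraMap]
      exact this.isUnit)
  refine ⟨a, by rwa [IsRoot, eval_map_algebraMap] at ha, ?_⟩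
  rwa [← sub_eq_zero, ← map_sub, residue_eq_zero_iff]

/-- A root of a polynomial with separable reduction is determined by its residue. -/
theorem eq_of_residue_eq {g : A[X]} (hs : (g.map (residue A)).Separable) {a b : B}
    (ha : aeval a g = 0) (hb : aeval b g = 0) (hab : residue B a = residue B b) : a = b := by
  refine IsLocalRing.eq_of_eval_eq_zero_of_not_isUnit_sub (f := g.map (algebraMap A B))
    (by rwa [eval_map_algebraMap]) (by rwa [eval_map_algebraMap]) ?_ ?_
  · rw [← residue_ne_zero_iff_isUnit, map_sub, hab, sub_self]
    simp
  · rw [derivative_map, eval_map_algebraMap, ← residue_ne_zero_iff_isUnit, ← aeval_residue,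
      ← derivative_map]
    exact hs.aeval_derivative_ne_zero (by rw [aeval_residue, ha, map_zero])

omit [IsLocalRing B] [IsLocalHom (algebraMap A B)] [Algebra A B] in
theorem exists_monic_lift_minpoly {l : Type*} [Field l] [Algebra (ResidueField A) l]
    {β : l} (hβ : IsIntegral (ResidueField A) β) :
    ∃ g : A[X], g.Monic ∧ g.map (residue A) = minpoly (ResidueField A) β := by
  obtain ⟨g, hg, -, hm⟩ := lifts_and_natDegree_eq_and_monic
    (f := residue A) (p := minpoly (ResidueField A) β)
    ((mem_lifts _).2 (map_surjective _ residue_surjective _)) (minpoly.monic hβ)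
  exact ⟨g, hm, hg⟩

/-- A complete local ring that is unramified over a complete local ring, with finite residue
extension, is a finite module. -/
theorem module_finite [IsAdicComplete (maximalIdeal A) A] [IsNoetherianRing B]
    [Module.Finite (ResidueField A) (ResidueField B)]
    (h : (maximalIdeal A).map (algebraMap A B) = maximalIdeal B) : Module.Finite A B := by
  let v := Module.finBasis (ResidueField A) (ResidueField B)
  choose w hw using fun i => residue_surjective (v i)
  let f := Fintype.linearCombination A w
  have := IsPrecomplete.pi (ι := Fin (Module.finrank (ResidueField A) (ResidueField B)))
    (maximalIdeal A)
  have hB : IsHausdorff (maximalIdeal A) B := by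
    rw [← IsHausdorff.map_algebraMap_iff (S := B), h]
    infer_instance
  -- The source is precomplete and `B` is Hausdorff for the ideal of `A`, so surjectivity may be
  -- checked modulo that ideal.
  refine Module.Finite.of_surjective f (surjective_of_mkQ_comp_surjective (I := maximalIdeal A) ?_)
  intro y
  obtain ⟨b, rfl⟩ := Submodule.mkQ_surjective _ y
  choose c hc using fun i => residue_surjective (v.repr (residue B b) i)
  refine ⟨c, ?_⟩
  rw [LinearMap.comp_apply, ← sub_eq_zero, ← map_sub, Submodule.mkQ_apply,
    Submodule.Quotient.mk_eq_zero, Ideal.smul_top_eq_map, h, Submodule.restrictScalars_mem,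
    ← residue_eq_zero_iff, map_sub, sub_eq_zero]
  conv_rhs => rw [← v.sum_repr (residue B b)]
  simp only [f, Fintype.linearCombination_apply, map_sum, ← hc, ← hw, Algebra.smul_def, map_mul,
    ResidueField.algebraMap_residue]

/-- A lift of a generator of the residue extension generates an unramified extension. -/
theorem adjoin_eq_top [Module.Finite A B]
    (h : (maximalIdeal A).map (algebraMap A B) = maximalIdeal B) {a : B}
    (ha : Algebra.adjoin (ResidueField A) {residue B a} = ⊤) : Algebra.adjoin A {a} = ⊤ := by
  rw [← Algebra.toSubmodule_eq_top, eq_top_iff]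
  -- Nakayama: it suffices that `B = A[a] + 𝔪_A B`.
  refine Submodule.le_of_le_smul_of_le_jacobson_bot (I := maximalIdeal A) Module.Finite.fg_top
    (maximalIdeal_le_jacobson _) fun b _ => ?_
  have hb : residue B b ∈ Algebra.adjoin (ResidueField A) {residue B a} := ha ▸ trivial
  rw [Algebra.adjoin_singleton_eq_range_aeval] at hb
  obtain ⟨p, hp⟩ := hb
  obtain ⟨P, rfl⟩ := map_surjective (residue A) residue_surjective p
  have hP : b - aeval a P ∈ (maximalIdeal A • ⊤ : Submodule A B) := by
    rw [Ideal.smul_top_eq_map, h, Submodule.restrictScalars_mem, ← residue_eq_zero_iff, map_sub,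
      sub_eq_zero, ← aeval_residue]
    exact hp.symm
  rw [← add_sub_cancel (aeval a P) b]
  exact Submodule.add_mem_sup (aeval_mem_adjoin_singleton A a) hP

end Integral

/-! ### Passage to the fraction fields. -/

section Field

variable {A B K L : Type*} [CommRing A] [CommRing B] [IsDomain A] [IsDomain B]
  [IsDiscreteValuationRing A] [IsDiscreteValuationRing B] [Algebra A B]
  [IsLocalHom (algebraMap A B)]
  [Field K] [Field L] [Algebra A K] [IsFractionRing A K] [Algebra B L] [IsFractionRing B L]
  [Algebra A L] [Algebra K L] [IsScalarTower A K L] [IsScalarTower A B L]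

-- Irreducibility of the reduction gives irreducibility of the monic `g` over `A`, and Gauss's lemma
-- carries it to `K`.
omit [IsDomain B] [IsDiscreteValuationRing B] [IsLocalHom (algebraMap A B)]
  [IsFractionRing B L] in
theorem minpoly_eq {g : A[X]} (hg : g.Monic) (hi : Irreducible (g.map (residue A))) {a : B}
    (ha : aeval a g = 0) : minpoly K (algebraMap B L a) = g.map (algebraMap A K) := by
  symm
  refine minpoly.eq_of_irreducible_of_monic ?_ ?_ (hg.map _)
  · exact (hg.irreducible_iff_irreducible_map_fraction_map (K := K)).1
      (hg.irreducible_of_irreducible_map (residue A) _ hi)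
  · rw [aeval_map_algebraMap, aeval_algebraMap_apply, ha, map_zero]

omit [IsDomain A] [IsDomain B] [IsDiscreteValuationRing A] [IsDiscreteValuationRing B]
  [IsLocalHom (algebraMap A B)] [IsFractionRing A K] in
theorem adjoin_field_eq_top [FiniteDimensional K L] {a : B} (ha : Algebra.adjoin A {a} = ⊤) :
    Algebra.adjoin K {algebraMap B L a} = ⊤ := by
  have key (b : B) : algebraMap B L b ∈ IntermediateField.adjoin K {algebraMap B L a} := by
    have hb : b ∈ Algebra.adjoin A {a} := ha ▸ trivial
    rw [Algebra.adjoin_singleton_eq_range_aeval] at hb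
    obtain ⟨p, rfl⟩ := hb
    change algebraMap B L (aeval a p) ∈ _
    rw [← aeval_algebraMap_apply, ← aeval_map_algebraMap K]
    exact IntermediateField.algebra_adjoin_le_adjoin K _
      (aeval_mem_adjoin_singleton K (algebraMap B L a))
  rw [← IntermediateField.adjoin_simple_toSubalgebra_of_isAlgebraic
    (Algebra.IsAlgebraic.isAlgebraic _), ← IntermediateField.top_toSubalgebra]
  congr 1
  rw [eq_top_iff]
  intro x _
  obtain ⟨b, c, -, rfl⟩ := IsFractionRing.div_surjective (A := B) x
  exact div_mem (key b) (key c)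

section Complete

variable [IsAdicComplete (maximalIdeal B) B] [Finite (ResidueField B)] [Module.Finite A B]
  [FiniteDimensional K L]

variable (A B) in
/-- An unramified extension of complete discrete valuation rings with finite residue fields is
Galois. -/
theorem isGalois (h : (maximalIdeal A).map (algebraMap A B) = maximalIdeal B) : IsGalois K L := by
  classical
  have : Finite (ResidueField A) :=
    Finite.of_injective _ (algebraMap (ResidueField A) (ResidueField B)).injective
  -- Only a generator is wanted here; the prescribed norm 1 is a dummy value.
  obtain ⟨β, -, hβ⟩ := FiniteField.exists_norm_eq_and_adjoin_eq_top (ResidueField A)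
    (ResidueField B) 1
  have hint : IsIntegral (ResidueField A) β := Algebra.IsIntegral.isIntegral β
  obtain ⟨g, hg, hgβ⟩ := exists_monic_lift_minpoly (A := A) (Algebra.IsIntegral.isIntegral β)
  have hs : (g.map (residue A)).Separable := hgβ ▸ Algebra.IsSeparable.isSeparable _ β
  have hi : Irreducible (g.map (residue A)) := hgβ ▸ minpoly.irreducible hint
  obtain ⟨a, ha, rfl⟩ := exists_root_residue_eq hg hs (β := β) (by rw [hgβ, minpoly.aeval])
  have hmin := minpoly_eq (K := K) (L := L) hg hi ha
  have hadj := adjoin_field_eq_top (K := K) (L := L) (adjoin_eq_top h hβ)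
  have hL : IsIntegral K (algebraMap B L a) := Algebra.IsIntegral.isIntegral _
  have hinj : Function.Injective (algebraMap B L) := IsFractionRing.injective B L
  set f := g.map (algebraMap A K) with hf
  have hf0 : f ≠ 0 := (hg.map _).ne_zero
  have hsep : f.Separable := by
    have hirr : Irreducible f := hmin ▸ minpoly.irreducible hL
    rw [separable_iff_derivative_ne_zero hirr]
    intro h0
    have h1 : algebraMap B L (aeval a (derivative g)) = 0 := by
      rw [← aeval_algebraMap_apply, ← aeval_map_algebraMap K, ← derivative_map, ← hf, h0, map_zero]
    have h2 : aeval a (derivative g) = 0 := hinj (by rw [h1, map_zero])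
    have h3 := hs.aeval_derivative_ne_zero (x := residue B a) (by rw [aeval_residue, ha, map_zero])
    rw [derivative_map, aeval_residue, h2, map_zero] at h3
    exact h3 rfl
  -- The reduction of `g` has `deg g` distinct roots in the residue field of `B`, by normality, and
  -- Hensel lifts them to distinct roots of `f`.
  have hsplit : (f.map (algebraMap K L)).Splits := by
    have hdeg : Fintype.card ((g.map (residue A)).rootSet (ResidueField B)) = g.natDegree := by
      rw [card_rootSet_eq_natDegree hs (hgβ ▸ Normal.splits inferInstance _), hg.natDegree_map]
    choose r hr hrγ using fun γ : (g.map (residue A)).rootSet (ResidueField B) =>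
      exists_root_residue_eq hg hs (aeval_eq_zero_of_mem_rootSet γ.2)
    have hle : g.natDegree ≤ Fintype.card (f.rootSet L) := by
      rw [← hdeg]
      refine Fintype.card_le_of_injective (fun γ => ⟨algebraMap B L (r γ), ?_⟩) fun γ δ hγδ => ?_
      · rw [mem_rootSet_of_ne hf0, hf, aeval_map_algebraMap, aeval_algebraMap_apply, hr, map_zero]
      · have := hinj (congrArg Subtype.val hγδ)
        exact Subtype.ext (by rw [← hrγ γ, ← hrγ δ, this])
    rw [splits_iff_card_roots]
    refine le_antisymm (card_roots' _) ?_
    rw [natDegree_map, hf, hg.natDegree_map]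
    refine hle.trans ?_
    simp_rw [rootSet_def, Finset.coe_sort_coe, Fintype.card_coe]
    exact Multiset.toFinset_card_le _
  have : f.IsSplittingField K L := by
    refine ⟨hsplit, ?_⟩
    rw [eq_top_iff, ← hadj]
    refine Algebra.adjoin_mono ?_
    rw [Set.singleton_subset_iff, mem_rootSet_of_ne hf0, ← hmin]
    exact minpoly.aeval _ _
  exact IsGalois.of_separable_splitting_field hsep

variable (A B) in
/-- The Galois group of an unramified extension of complete discrete valuation rings with finite
residue fields is cyclic. -/
theorem isCyclic_gal (h : (maximalIdeal A).map (algebraMap A B) = maximalIdeal B) :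
    IsCyclic Gal(L/K) := by
  have : Finite (ResidueField A) :=
    Finite.of_injective _ (algebraMap (ResidueField A) (ResidueField B)).injective
  let φ : (B ≃ₐ[A] B) →* Gal(ResidueField B/ResidueField A) :=
    { toFun := ResidueField.mapAlgEquiv'
      map_one' := by
        ext x
        obtain ⟨x, rfl⟩ := residue_surjective x
        rfl
      map_mul' := fun σ τ => by
        ext x
        obtain ⟨x, rfl⟩ := residue_surjective x
        rfl }
  have hφ : Function.Injective φ := by
    rw [injective_iff_map_eq_one]
    intro σ hσ
    obtain ⟨β, -, hβ⟩ := FiniteField.exists_norm_eq_and_adjoin_eq_top (ResidueField A)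
      (ResidueField B) 1
    obtain ⟨g, hg, hgβ⟩ := exists_monic_lift_minpoly (A := A) (Algebra.IsIntegral.isIntegral β)
    have hs : (g.map (residue A)).Separable := hgβ ▸ Algebra.IsSeparable.isSeparable _ β
    obtain ⟨a, ha, rfl⟩ := exists_root_residue_eq hg hs (β := β) (by rw [hgβ, minpoly.aeval])
    -- Both are roots of `g` with the same residue, and such a root is unique.
    have hσa : σ a = a := by
      refine eq_of_residue_eq hs ?_ ha (DFunLike.congr_fun hσ (residue B a))
      change aeval (σ.toAlgHom a) g = 0
      rw [aeval_algHom_apply, ha, map_zero]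
    have : (σ : B →ₐ[A] B) = AlgHom.id A B := by
      refine AlgHom.ext_of_adjoin_eq_top (adjoin_eq_top h hβ) ?_
      rintro _ rfl
      exact hσa
    ext x
    exact DFunLike.congr_fun this x
  exact isCyclic_of_injective (φ.comp (galRestrict A K L B).toMonoidHom)
    (hφ.comp (galRestrict A K L B).injective)

variable (B K L) in
/-- Every unit is the norm of a unit in an unramified extension of complete discrete valuation
rings with finite residue fields. -/
theorem exists_norm_eq (h : (maximalIdeal A).map (algebraMap A B) = maximalIdeal B) (u : Aˣ) :
    ∃ b : Bˣ, Algebra.norm K (algebraMap B L b) = algebraMap A K u := by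
  obtain ⟨β, hβu, hβ⟩ := FiniteField.exists_norm_eq_and_adjoin_eq_top (ResidueField A)
    (ResidueField B) (Units.map (residue A : A →* ResidueField A) u)
  have hint : IsIntegral (ResidueField A) β := Algebra.IsIntegral.isIntegral β
  obtain ⟨g₀, hg₀, hgβ₀⟩ := exists_monic_lift_minpoly (A := A) (Algebra.IsIntegral.isIntegral β)
  have hpos : 0 < g₀.natDegree := by
    rw [← hg₀.natDegree_map (residue A), hgβ₀]
    exact minpoly.natDegree_pos hint
  -- Correction making the constant term of `g` equal to `(-1)^n u`. It vanishes in the residue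
  -- field because `β` has norm the residue of `u`, so the reduction is unaffected.
  let c : A := (-1) ^ g₀.natDegree * u - g₀.coeff 0
  have hc : residue A c = 0 := by
    have hn := Algebra.PowerBasis.norm_gen_eq_coeff_zero_minpoly
      (PowerBasis.ofAdjoinEqTop' hint hβ)
    rw [PowerBasis.ofAdjoinEqTop'_gen, PowerBasis.ofAdjoinEqTop'_dim, hβu, ← hgβ₀,
      hg₀.natDegree_map, coeff_map] at hn
    have hn' : residue A u = (-1) ^ g₀.natDegree * residue A (g₀.coeff 0) := hn
    simp only [c, map_sub, map_mul, map_pow, map_neg, map_one, hn']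
    rw [← mul_assoc, ← pow_add, Even.neg_one_pow ⟨_, rfl⟩, one_mul, sub_self]
  let g := g₀ + C c
  have hdeg : (C c).degree < g₀.degree :=
    degree_C_le.trans_lt (natDegree_pos_iff_degree_pos.1 hpos)
  have hg : g.Monic := hg₀.add_of_left hdeg
  have hgn : g.natDegree = g₀.natDegree := natDegree_add_eq_left_of_degree_lt hdeg
  have hgβ : g.map (residue A) = minpoly (ResidueField A) β := by
    simp [g, hgβ₀, hc]
  have hs : (g.map (residue A)).Separable := hgβ ▸ Algebra.IsSeparable.isSeparable _ β
  have hi : Irreducible (g.map (residue A)) := hgβ ▸ minpoly.irreducible hint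
  obtain ⟨a, ha, rfl⟩ := exists_root_residue_eq hg hs (β := β) (by rw [hgβ, minpoly.aeval])
  have hmin := minpoly_eq (K := K) (L := L) hg hi ha
  have hadj := adjoin_field_eq_top (K := K) (L := L) (adjoin_eq_top h hβ)
  have hunit : IsUnit a := by
    rw [← residue_ne_zero_iff_isUnit]
    intro h0
    rw [h0, Algebra.norm_zero] at hβu
    exact (Units.ne_zero _) hβu.symm
  refine ⟨hunit.unit, ?_⟩
  have hn := Algebra.PowerBasis.norm_gen_eq_coeff_zero_minpoly
    (PowerBasis.ofAdjoinEqTop' (Algebra.IsIntegral.isIntegral _) hadj)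
  rw [PowerBasis.ofAdjoinEqTop'_gen, PowerBasis.ofAdjoinEqTop'_dim, hmin,
    hg.natDegree_map, coeff_map, hgn] at hn
  rw [IsUnit.unit_spec, hn]
  simp only [g, c, coeff_add, coeff_C_zero, add_sub_cancel, map_mul, map_pow, map_neg, map_one]
  rw [← mul_assoc, ← pow_add, Even.neg_one_pow ⟨_, rfl⟩, one_mul]

end Complete

omit [IsLocalHom (algebraMap A B)] [IsFractionRing A K] in
/-- Hilbert's theorem 90 for the units of an unramified extension. -/
theorem exists_unit_div_eq_of_norm_eq_one [FiniteDimensional K L] [IsGalois K L]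
    (h : (maximalIdeal A).map (algebraMap A B) = maximalIdeal B)
    {σ : Gal(L/K)} (hσ : ∀ τ, τ ∈ Subgroup.zpowers σ) {x : L} (hx : Algebra.norm K x = 1) :
    ∃ y : Bˣ, algebraMap B L y / σ (algebraMap B L y) = x := by
  obtain ⟨z, hz0, hz⟩ := exists_div_eq_of_norm_eq_one hσ hx
  obtain ⟨ϖ, hϖ⟩ := IsDiscreteValuationRing.exists_irreducible A
  have hϖB : Irreducible (algebraMap A B ϖ) := by
    rw [IsDiscreteValuationRing.irreducible_iff_uniformizer, ← h, hϖ.maximalIdeal_eq,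
      Ideal.map_span, Set.image_singleton]
  obtain ⟨b, c, hc, hbc⟩ := IsFractionRing.div_surjective (A := B) z
  have hc0 : c ≠ 0 := nonZeroDivisors.ne_zero hc
  have hb0 : b ≠ 0 := by
    rintro rfl
    exact hz0 (by rw [← hbc, map_zero, zero_div])
  obtain ⟨m, u, rfl⟩ := IsDiscreteValuationRing.eq_unit_mul_pow_irreducible hb0 hϖB
  obtain ⟨n, v, rfl⟩ := IsDiscreteValuationRing.eq_unit_mul_pow_irreducible hc0 hϖB
  have hinj : Function.Injective (algebraMap B L) := IsFractionRing.injective B L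
  have hp : algebraMap B L (algebraMap A B ϖ) = algebraMap K L (algebraMap A K ϖ) := by
    rw [← IsScalarTower.algebraMap_apply, ← IsScalarTower.algebraMap_apply]
  have hp0 : algebraMap K L (algebraMap A K ϖ) ≠ 0 := by
    rw [← hp]
    exact (map_ne_zero_iff _ hinj).2 hϖB.ne_zero
  have hu (w : Bˣ) : algebraMap B L w ≠ 0 := (map_ne_zero_iff _ hinj).2 w.ne_zero
  have hu' (w : Bˣ) : σ (algebraMap B L w) ≠ 0 := (map_ne_zero σ).2 (hu w)
  have huv : algebraMap B L ((u / v : Bˣ) : B) = algebraMap B L u / algebraMap B L v := by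
    rw [eq_div_iff (hu v), ← map_mul, ← Units.val_mul, div_mul_cancel]
  refine ⟨u / v, ?_⟩
  rw [← hz, ← hbc, huv]
  simp only [map_div₀, map_mul, map_pow, hp, AlgEquiv.commutes]
  have h1 := hu v
  have h2 := hu' u
  have h3 := hu' v
  field_simp

end Field

end UnramifiedDVR

/-! ### Unit groups of local fields. -/

namespace LocalUnits

open ValuativeRel IsLocalRing

section Units

variable (E : Type*) [Field E] [ValuativeRel E]

theorem isUnit_integer_iff {x : 𝒪[E]} : IsUnit x ↔ valuation E (x : E) = 1 :=
  Valuation.Integers.isUnit_iff_valuation_eq_one (Valuation.integer.integers (valuation E))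

theorem exists_unit_coe_eq {x : E} (hx : valuation E x = 1) : ∃ u : 𝒪[E]ˣ, ((u : 𝒪[E]) : E) = x :=
  ⟨((isUnit_integer_iff E).2 hx : IsUnit (⟨x, hx.le⟩ : 𝒪[E])).unit, rfl⟩

theorem valuation_coe_unit (u : 𝒪[E]ˣ) : valuation E ((u : 𝒪[E]) : E) = 1 :=
  (isUnit_integer_iff E).1 u.isUnit

theorem coe_unit_injective {a b : 𝒪[E]ˣ} (h : ((a : 𝒪[E]) : E) = (b : 𝒪[E])) : a = b :=
  Units.ext (Subtype.ext h)

theorem isAdicComplete_integer [TopologicalSpace E] [IsNonarchimedeanLocalField E] :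
    IsAdicComplete 𝓂[E] 𝒪[E] := by
  let := IsTopologicalAddGroup.rightUniformSpace E
  have := isUniformAddGroup_of_addCommGroup (G := E)
  infer_instance

end Units

variable (K : Type v) (L : Type u)
  [Field K] [ValuativeRel K] [TopologicalSpace K] [IsNonarchimedeanLocalField K]
  [Field L] [ValuativeRel L] [TopologicalSpace L] [IsNonarchimedeanLocalField L]
  [Algebra K L]

omit [TopologicalSpace K] [IsNonarchimedeanLocalField K] [TopologicalSpace L]
  [IsNonarchimedeanLocalField L] in
theorem valuation_algebraMap_eq_one_iff [ValuativeExtension K L] {x : K} :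
    valuation L (algebraMap K L x) = 1 ↔ valuation K x = 1 := by
  rw [← ValuativeExtension.mapValueGroupWithZero_valuation,
    ← map_one (ValuativeExtension.mapValueGroupWithZero K L)]
  exact ValuativeExtension.mapValueGroupWithZero_strictMono.injective.eq_iff

omit [ValuativeRel K] [TopologicalSpace K] [IsNonarchimedeanLocalField K] in
theorem coe_unitsRepresentation_apply (σ : Gal(L/K)) (a : Additive 𝒪[L]ˣ) :
    (((unitsRepresentation K L σ a).toMul : 𝒪[L]) : L) = σ (a.toMul : 𝒪[L]) := rfl

-- This ties the cohomological norm to the field norm: for a Galois extension both are the product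
-- of the conjugates.
omit [ValuativeRel K] [TopologicalSpace K] [IsNonarchimedeanLocalField K] in
theorem coe_unitsRepresentation_norm [FiniteDimensional K L] [IsGalois K L] (a : Additive 𝒪[L]ˣ) :
    ((((unitsRepresentation K L).norm a).toMul : 𝒪[L]) : L) =
      algebraMap K L (Algebra.norm K ((a.toMul : 𝒪[L]) : L)) := by
  rw [Algebra.norm_eq_prod_automorphisms, Representation.norm, LinearMap.sum_apply, toMul_sum,
    Units.coe_prod]
  exact map_prod 𝒪[L].subtype _ _

omit [TopologicalSpace K] [IsNonarchimedeanLocalField K] in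
theorem valuation_norm_unit [ValuativeExtension K L] [FiniteDimensional K L] [IsGalois K L]
    (x : 𝒪[L]ˣ) : valuation K (Algebra.norm K ((x : 𝒪[L]) : L)) = 1 := by
  rw [← valuation_algebraMap_eq_one_iff K L]
  have := coe_unitsRepresentation_norm K L (Additive.ofMul x)
  rw [toMul_ofMul] at this
  rw [← this]
  exact valuation_coe_unit L _

/-- The norm of a finite Galois extension of local fields on unit groups. -/
noncomputable def unitsNorm [ValuativeExtension K L] [FiniteDimensional K L] [IsGalois K L] :
    𝒪[L]ˣ →* 𝒪[K]ˣ where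
  toFun x := (exists_unit_coe_eq K (valuation_norm_unit K L x)).choose
  map_one' := coe_unit_injective K <| by
    rw [(exists_unit_coe_eq K (valuation_norm_unit K L 1)).choose_spec]
    simp
  map_mul' x y := coe_unit_injective K <| by
    rw [(exists_unit_coe_eq K (valuation_norm_unit K L (x * y))).choose_spec, Units.val_mul,
      Units.val_mul, Subring.coe_mul, Subring.coe_mul, map_mul,
      (exists_unit_coe_eq K (valuation_norm_unit K L x)).choose_spec,
      (exists_unit_coe_eq K (valuation_norm_unit K L y)).choose_spec]

omit [TopologicalSpace K] [IsNonarchimedeanLocalField K] in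
theorem coe_unitsNorm [ValuativeExtension K L] [FiniteDimensional K L] [IsGalois K L]
    (x : 𝒪[L]ˣ) : ((unitsNorm K L x : 𝒪[K]) : K) = Algebra.norm K ((x : 𝒪[L]) : L) :=
  (exists_unit_coe_eq K (valuation_norm_unit K L x)).choose_spec

/-- A finite unramified extension `L / K` of local fields is Galois with cyclic Galois group,
every unit of `K` is the norm of a unit of `L`, and Hilbert's theorem 90 holds for units. -/
theorem isGalois_and_isCyclic_and_norm_units [ValuativeExtension K L] [FiniteDimensional K L]
    (hunr : IsUnramified K L) :
    IsGalois K L ∧ IsCyclic Gal(L/K) ∧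
    (∀ u : 𝒪[K]ˣ, ∃ b : 𝒪[L]ˣ, Algebra.norm K ((b : 𝒪[L]) : L) = (u : 𝒪[K])) ∧
    ∀ σ : Gal(L/K), (∀ τ, τ ∈ Subgroup.zpowers σ) → ∀ x : L, Algebra.norm K x = 1 →
      ∃ y : 𝒪[L]ˣ, ((y : 𝒪[L]) : L) / σ (y : 𝒪[L]) = x := by
  let : Algebra 𝒪[K] 𝒪[L] := (integerMap K L).toAlgebra
  have : IsScalarTower 𝒪[K] 𝒪[L] L := .of_algebraMap_eq fun _ => rfl
  have : IsLocalHom (algebraMap 𝒪[K] 𝒪[L]) := by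
    refine ⟨fun x hx => ?_⟩
    rw [isUnit_integer_iff] at hx ⊢
    exact (valuation_algebraMap_eq_one_iff K L).1 hx
  have := isAdicComplete_integer K
  have := isAdicComplete_integer L
  have h : (maximalIdeal 𝒪[K]).map (algebraMap 𝒪[K] 𝒪[L]) = maximalIdeal 𝒪[L] := hunr
  have := UnramifiedDVR.module_finite h
  have := UnramifiedDVR.isGalois 𝒪[K] 𝒪[L] (K := K) (L := L) h
  exact ⟨this, UnramifiedDVR.isCyclic_gal 𝒪[K] 𝒪[L] h, UnramifiedDVR.exists_norm_eq 𝒪[L] K L h,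
    fun σ hσ x hx => UnramifiedDVR.exists_unit_div_eq_of_norm_eq_one (A := 𝒪[K]) h hσ hx⟩

end LocalUnits

theorem mainTheorem6
    (K : Type v) (L : Type u)
    [Field K] [ValuativeRel K] [TopologicalSpace K] [IsNonarchimedeanLocalField K]
    [Field L] [ValuativeRel L] [TopologicalSpace L] [IsNonarchimedeanLocalField L]
    [Algebra K L] [ValuativeExtension K L] [FiniteDimensional K L]
    (hunr : LocalUnits.IsUnramified K L) :
    (∀ r : ℤ, CategoryTheory.Limits.IsZero (tateCohomology (LocalUnits.unitsRep K L) r)) ∧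
    ∃ N : 𝒪[L]ˣ →* 𝒪[K]ˣ,
      (∀ x : 𝒪[L]ˣ, ((N x : 𝒪[K]) : K) = Algebra.norm K ((x : 𝒪[L]) : L)) ∧
      Function.Surjective N := by
  obtain ⟨_, _, hnorm, h90⟩ := LocalUnits.isGalois_and_isCyclic_and_norm_units K L hunr
  refine ⟨fun r => ?_, LocalUnits.unitsNorm K L, LocalUnits.coe_unitsNorm K L, fun u => ?_⟩
  · obtain ⟨σ, hσ⟩ := IsCyclic.exists_generator (α := Gal(L/K))
    let ρ := LocalUnits.unitsRepresentation K L
    suffices h : (∀ x, ρ σ x = x → ∃ y, ρ.norm y = x) ∧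
        ∀ x, ρ.norm x = 0 → ∃ y, ρ σ y - y = x from
      isZero_tateCohomology_of_forall_mem_zpowers _ σ hσ h.1 h.2 r
    refine ⟨fun x hx => ?_, fun x hx => ?_⟩
    · have hx' : σ (x.toMul : 𝒪[L]) = ((x.toMul : 𝒪[L]) : L) := by
        rw [← LocalUnits.coe_unitsRepresentation_apply]
        exact congrArg (fun z : Additive 𝒪[L]ˣ => ((z.toMul : 𝒪[L]) : L)) hx
      have hfix (τ : Gal(L/K)) : τ (x.toMul : 𝒪[L]) = ((x.toMul : 𝒪[L]) : L) := by
        have : Subgroup.zpowers σ ≤ MulAction.stabilizer Gal(L/K) ((x.toMul : 𝒪[L]) : L) := by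
          rw [Subgroup.zpowers_le]
          exact hx'
        exact this (hσ τ)
      obtain ⟨a, ha⟩ := (IsGalois.mem_range_algebraMap_iff_fixed _).2 hfix
      obtain ⟨u, rfl⟩ := LocalUnits.exists_unit_coe_eq K
        ((LocalUnits.valuation_algebraMap_eq_one_iff K L).1
          (ha ▸ LocalUnits.valuation_coe_unit L _))
      obtain ⟨b, hb⟩ := hnorm u
      refine ⟨Additive.ofMul b, Additive.toMul.injective (LocalUnits.coe_unit_injective L ?_)⟩
      rw [LocalUnits.coe_unitsRepresentation_norm, toMul_ofMul, hb, ha]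
    · have hx' : Algebra.norm K ((x.toMul : 𝒪[L]) : L) = 1 := by
        apply (algebraMap K L).injective
        rw [← LocalUnits.coe_unitsRepresentation_norm, hx, map_one]
        rfl
      obtain ⟨y, hy⟩ := h90 σ hσ _ hx'
      -- Hilbert 90 gives `x = y / σ y`, while `σ w / w = x` is wanted, so `w = y⁻¹`.
      refine ⟨Additive.ofMul y⁻¹, ?_⟩
      have hy' : LocalUnits.unitsRepresentation K L σ (Additive.ofMul y⁻¹) =
          (x + Additive.ofMul y⁻¹ : Additive 𝒪[L]ˣ) := by
        refine Additive.toMul.injective (LocalUnits.coe_unit_injective L ?_)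
        rw [LocalUnits.coe_unitsRepresentation_apply, toMul_add, toMul_ofMul, Units.val_mul,
          Subring.coe_mul, ← hy]
        have hinv : (((y⁻¹ : 𝒪[L]ˣ) : 𝒪[L]) : L) = ((y : 𝒪[L]) : L)⁻¹ := by
          apply eq_inv_of_mul_eq_one_right
          rw [← Subring.coe_mul, Units.mul_inv, Subring.coe_one]
        have hy0 : ((y : 𝒪[L]) : L) ≠ 0 := fun h0 => y.ne_zero (Subtype.ext h0)
        rw [hinv, map_inv₀, div_mul_eq_mul_div, mul_inv_cancel₀ hy0, one_div]
      rw [hy']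
      exact add_sub_cancel_right _ _
  · obtain ⟨b, hb⟩ := hnorm u
    exact ⟨b, LocalUnits.coe_unit_injective K (by rw [LocalUnits.coe_unitsNorm, hb])⟩
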